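/- Let $0<H<1$ and let $X=(X(t))_{t\in\mathbb R}$ be a real-valued process on a probability space which is a volatility modulated mixed moving average process, i.e. $$X(t)=\int_{\mathcal X\times\mathbb R} g(x,t-s)\,\sigma(s)\,W(dx,ds),\qquad t\in\mathbb R,$$ where $\mathcal X$ is a measurable space with a probability measure $p$, $W$ is a standard Gaussian independently scattered random measure on $\mathcal X\times\mathbb R$ with control measure $p(dx)\,ds$, $g:\mathcal X\times\mathbb R\to\mathbb R$ is measurable, $\sigma$ is a jointly measurable, strictly stationary process independent of $W$, $\int g^2(x,t-s)\,\mathbb E(\sigma^2(s))\,p(dx)\,ds<\infty$ for all $t$, and the integral is the $L^2$-limit of integrals of simple integrands whose coefficients are bounded and measurable with respect to the $\sigma$-algebra generated by $\sigma$; or, alternatively, let $X$ be any centred, square integrable, strictly stationary real-valued process. Write $\rho_X(h)=\operatorname{Cor}(X(h),X(0))$. Suppose that $X$ has spectral density $$\gamma(w)=\frac1{2\pi}\sum_{k=0}^{\infty}\binom{2H}{k}(-1)^{k-1}\frac{k-H}{(k-H)^2+w^2},\qquad w\in\mathbb R,$$ meaning that $\gamma$ is nonnegative almost everywhere and integrable,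 and that $\rho_X(h)=\int_{\mathbb R}e^{ihw}\gamma(w)\,dw$ for all $h\in\mathbb R$. Then the series defining $\gamma$ converges absolutely for every $w\in\mathbb R$, and $$\rho_X(h)=\cosh(hH)-2^{2H-1}\,\bigl|\sinh(h/2)\bigr|^{2H},\qquad h\in\mathbb R.$$ Moreover, the process $Y=(Y(t))_{t>0}$ defined by $Y(t)=t^H X(\log t)$ is $H$-self-similar, i.e. for every $a>0$ the processes $(Y(at))_{t>0}$ and $(a^HY(t))_{t>0}$ have the same finite dimensional distributions, and it has second-order stationary increments, i.e. $Y(t)$ is square integrable and $\mathbb E\bigl[(Y(t+h)-Y(t))^2\bigr]=\mathbb E\bigl[Y(h)^2\bigr]$ for all $t,h>0$. -/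

import Mathlib

open MeasureTheory ProbabilityTheory Filter Topology
open scoped ENNReal

universe u v

noncomputable section

/-! ### Distributional properties of real-valued processes -/

/-- The processes `X` and `Y` with index set `T` have the same finite dimensional distributions. -/
def SameFDD {Ω : Type u} [MeasurableSpace Ω] (P : Measure Ω) {T : Type*} (X Y : T → Ω → ℝ) : Prop :=
  ∀ (n : ℕ) (t : Fin n → T),
    IdentDistrib (fun ω (i : Fin n) => X (t i) ω) (fun ω (i : Fin n) => Y (t i) ω) P P

/-- Strict stationarity of a process indexed by the real line. -/
def IsStrictlyStationary {Ω : Type u} [MeasurableSpace Ω] (P : Measure Ω) (X : ℝ → Ω → ℝ) : Prop :=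
  ∀ τ : ℝ, SameFDD P (fun t => X (t + τ)) X

/-- A centred, square integrable, strictly stationary process. -/
structure IsCentredStationary {Ω : Type u} [MeasurableSpace Ω] (P : Measure Ω)
    (X : ℝ → Ω → ℝ) : Prop where
  memLp : ∀ t, MemLp (X t) 2 P
  centred : ∀ t, ∫ ω, X t ω ∂P = 0
  stationary : IsStrictlyStationary P X

/-- The correlation function `ρ_X(h) = Cor(X(h), X(0))`. -/
def correlationFunction {Ω : Type u} [MeasurableSpace Ω] (P : Measure Ω) (X : ℝ → Ω → ℝ)
    (h : ℝ) : ℝ :=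
  covariance (X h) (X 0) P / (√(variance (X h) P) * √(variance (X 0) P))

/-- `f` is the spectral density of `X`: a nonnegative integrable function with
`ρ_X(h) = ∫ e^{ihw} f(w) dw` for all real `h`. (At `h = 0` this forces `Var X(0) ≠ 0` as soon as
`f` has nonzero integral.) -/
structure HasSpectralDensity {Ω : Type u} [MeasurableSpace Ω] (P : Measure Ω) (X : ℝ → Ω → ℝ)
    (f : ℝ → ℝ) : Prop where
  nonneg : ∀ᵐ w, 0 ≤ f w
  integrable : Integrable f
  correlation_eq : ∀ h : ℝ, (correlationFunction P X h : ℂ) =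
    ∫ w : ℝ, Complex.exp (Complex.I * (h : ℂ) * (w : ℂ)) * (f w : ℂ)

/-- The process `Y(t) = t ^ H * X (log t)`, `t > 0`. -/
def lamperti {Ω : Type u} (H : ℝ) (X : ℝ → Ω → ℝ) : {t : ℝ // 0 < t} → Ω → ℝ :=
  fun t ω => (t : ℝ) ^ H * X (Real.log t) ω

/-- `Y = (Y(t))_{t > 0}` is self-similar with index `H > 0`: for all `a > 0`, the processes
`(Y(a t))_{t > 0}` and `(a ^ H Y(t))_{t > 0}` have the same finite dimensional distributions. -/
def IsSelfSimilar {Ω : Type u} [MeasurableSpace Ω] (P : Measure Ω) (H : ℝ)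
    (Y : {t : ℝ // 0 < t} → Ω → ℝ) : Prop :=
  0 < H ∧ ∀ a : {a : ℝ // 0 < a},
    SameFDD P (fun t => Y (a * t)) (fun t ω => (a : ℝ) ^ H * Y t ω)

/-- `Y = (Y(t))_{t > 0}` has second-order stationary (translation-invariant) increments: it is
square integrable and `E (Y(t + h) - Y(t))² = E Y(h)²` for all `t, h > 0`. -/
def HasSecondOrderStationaryIncrements {Ω : Type u} [MeasurableSpace Ω] (P : Measure Ω)
    (Y : {t : ℝ // 0 < t} → Ω → ℝ) : Prop :=
  (∀ t, MemLp (Y t) 2 P) ∧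
    ∀ t h, ∫ ω, (Y (t + h) ω - Y t ω) ^ 2 ∂P = ∫ ω, (Y h ω) ^ 2 ∂P

/-! ### Gaussian random measures and volatility modulated mixed moving averages -/

/-- The measurable sets of finite `c`-measure. -/
abbrev FiniteSets {S : Type*} [MeasurableSpace S] (c : Measure S) : Type _ :=
  {A : Set S // MeasurableSet A ∧ c A < ∞}

/-- `W` is a standard Gaussian independently scattered random measure with control measure `c`. -/
structure IsGaussianRandomMeasure {Ω : Type u} [MeasurableSpace Ω] (P : Measure Ω)
    {S : Type*} [MeasurableSpace S] (c : Measure S) (W : FiniteSets c → Ω → ℝ) : Prop where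
  measurable : ∀ A, Measurable (W A)
  law : ∀ A, P.map (W A) = gaussianReal 0 (c A.1).toNNReal
  indep : ∀ A : ℕ → FiniteSets c, Pairwise (fun i j => Disjoint (A i).1 (A j).1) →
    iIndepFun (fun i => W (A i)) P
  additive : ∀ (A : ℕ → FiniteSets c) (B : FiniteSets c),
    Pairwise (fun i j => Disjoint (A i).1 (A j).1) → B.1 = ⋃ i, (A i).1 →
    ∀ᵐ ω ∂P, Tendsto (fun n => ∑ i ∈ Finset.range n, W (A i) ω) atTop (𝓝 (W B ω))

/-- A simple random integrand `∑ i, ξ i (ω) * 1_{A i}(z)`. -/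
structure SimpleIntegrand (Ω : Type u) {S : Type*} [MeasurableSpace S] (c : Measure S) where
  n : ℕ
  A : Fin n → FiniteSets c
  ξ : Fin n → Ω → ℝ

/-- The random field given by a simple integrand. -/
def SimpleIntegrand.eval {Ω : Type u} {S : Type*} [MeasurableSpace S] {c : Measure S}
    (ψ : SimpleIntegrand Ω c) (z : S) (ω : Ω) : ℝ :=
  ∑ i, (ψ.A i).1.indicator (fun _ => ψ.ξ i ω) z

/-- The integral `∑ i, ξ i * W (A i)` of a simple integrand. -/
def SimpleIntegrand.integral {Ω : Type u} {S : Type*} [MeasurableSpace S] {c : Measure S}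
    (ψ : SimpleIntegrand Ω c) (W : FiniteSets c → Ω → ℝ) (ω : Ω) : ℝ :=
  ∑ i, ψ.ξ i ω * W (ψ.A i) ω

/-- `I` is (a version of) the stochastic integral `∫ φ(z) W(dz)`: it is the `L²(P)`-limit of the
integrals of simple integrands, with bounded `𝓖`-measurable coefficients, that converge to `φ`
in `L²(c ⊗ P)`. It is used below for a sigma-algebra `𝓖` independent of `W`. -/
def IsStochasticIntegral {Ω : Type u} (𝓖 : MeasurableSpace Ω) [MeasurableSpace Ω] (P : Measure Ω)
    {S : Type*} [MeasurableSpace S] (c : Measure S) (W : FiniteSets c → Ω → ℝ)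
    (φ : S → Ω → ℝ) (I : Ω → ℝ) : Prop :=
  MemLp I 2 P ∧ ∃ ψ : ℕ → SimpleIntegrand Ω c,
    (∀ k i, Measurable[𝓖] ((ψ k).ξ i) ∧ ∃ C : ℝ, ∀ ω, |(ψ k).ξ i ω| ≤ C) ∧
    Tendsto (fun k => eLpNorm (fun q : S × Ω => φ q.1 q.2 - (ψ k).eval q.1 q.2) 2 (c.prod P))
      atTop (𝓝 0) ∧
    Tendsto (fun k => eLpNorm (fun ω => I ω - (ψ k).integral W ω) 2 P) atTop (𝓝 0)

/-- `X` is the volatility modulated mixed moving average process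
`X(t) = ∫_{𝓧 × ℝ} g(x, t - s) σ(s) W(dx, ds)`: `W` is a standard Gaussian independently scattered
random measure with control measure `p(dx) ds` for a probability measure `p`, the weight function
`g` is measurable, the volatility `σ` is a (jointly measurable) strictly stationary process
independent of `W`, and `∫ g²(x, t - s) E(σ²(s)) p(dx) ds < ∞` for all `t`. -/
structure IsVMMMAOf {Ω : Type u} [MeasurableSpace Ω] (P : Measure Ω)
    {𝓧 : Type v} [MeasurableSpace 𝓧] (p : Measure 𝓧) (g : 𝓧 × ℝ → ℝ) (σ : ℝ → Ω → ℝ)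
    (W : FiniteSets (p.prod (volume : Measure ℝ)) → Ω → ℝ) (X : ℝ → Ω → ℝ) : Prop where
  probability : IsProbabilityMeasure p
  gaussian : IsGaussianRandomMeasure P (p.prod volume) W
  measurable_weight : Measurable g
  measurable_volatility : Measurable (fun q : ℝ × Ω => σ q.1 q.2)
  stationary_volatility : IsStrictlyStationary P σ
  indep : IndepFun (fun ω s => σ s ω) (fun ω A => W A ω) P
  integrability : ∀ t : ℝ,
    ∫⁻ z : 𝓧 × ℝ, ‖g (z.1, t - z.2)‖ₑ ^ 2 * (∫⁻ ω, ‖σ z.2 ω‖ₑ ^ 2 ∂P) ∂(p.prod volume) < ∞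
  eq_integral : ∀ t : ℝ,
    IsStochasticIntegral (MeasurableSpace.comap (fun ω s => σ s ω) MeasurableSpace.pi)
      P (p.prod volume) W
      (fun z ω => g (z.1, t - z.2) * σ z.2 ω) (X t)

/-- `X` is a volatility modulated mixed moving average process, for some mixing space, mixing
measure, weight function, volatility process and Gaussian random measure. -/
def IsVMMMA {Ω : Type u} [MeasurableSpace Ω] (P : Measure Ω) (X : ℝ → Ω → ℝ) : Prop :=
  ∃ (𝓧 : Type v) (_ : MeasurableSpace 𝓧) (p : Measure 𝓧) (g : 𝓧 × ℝ → ℝ) (σ : ℝ → Ω → ℝ)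
    (W : FiniteSets (p.prod (volume : Measure ℝ)) → Ω → ℝ), IsVMMMAOf P p g σ W X

/-! ### The spectral density -/

/-- The summand `binom(2H, k) (-1)^(k-1) (k - H) / ((k - H)² + w²)`, `k = 0, 1, 2, …`. -/
def spectralTerm (H w : ℝ) (k : ℕ) : ℝ :=
  Ring.choose (2 * H) k * (-1) ^ ((k : ℤ) - 1) * ((k - H) / ((k - H) ^ 2 + w ^ 2))

/-- `γ(w) = (2π)⁻¹ ∑_{k ≥ 0} binom(2H, k) (-1)^(k-1) (k - H) / ((k - H)² + w²)`. -/
def spectralDensity (H w : ℝ) : ℝ :=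
  1 / (2 * Real.pi) * ∑' k : ℕ, spectralTerm H w k

end

/-! The summand with index `k` is a multiple of a Cauchy kernel, and `(k - H) / ((k - H)² + w²)` has
Fourier transform `sign(k - H) π exp(-|k - H| |h|)`. All these kernels have `L¹`-norm `π` and the
coefficients `binom(2H, k)` are absolutely summable because `2H > 0`, so `γ` may be transformed term
by term. Only `k = 0` has `k - H < 0`; once its sign is corrected, what remains is the binomial
series of `(1 - e^{-|h|})^{2H}`. The result is `cosh(hH) - ½ e^{H|h|} (1 - e^{-|h|})^{2H}`, and `1 -
e^{-u} = 2 e^{-u/2} sinh(u/2)` gives the stated form (`fourier_spectralDensity`).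

The logarithm turns dilations into translations, so stationarity of `X` makes `Y` self-similar. With
`ρ_X` as above, the covariance of `Y` is, up to the variance of `X`, the covariance `½ ((t+h)^{2H} +
t^{2H} - h^{2H})` of fractional Brownian motion between the times `t + h` and `t`; this is
`lamperti_increment_identity`.

A moving average is reduced to the stationary case by `IsVMMMAOf.isCentredStationary`. Take simple
integrals converging to `X(t)`, translate their sets and shift the volatility path in their
coefficients. Their joint law is unchanged, since `W` and its control measure are invariant in law
under translation and `σ` is stationary and independent of `W`. By the isometry the new integrals
converge to `X(t + τ)`, and limits in distribution are unique. -/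

/-! ### Binomial series -/

theorem Ring.choose_succ_mul (r : ℝ) (k : ℕ) :
    ((k : ℝ) + 1) * Ring.choose r (k + 1) = (r - k) * Ring.choose r k := by
  have h1 := Ring.descPochhammer_eq_factorial_smul_choose r (k + 1)
  have h2 := Ring.descPochhammer_eq_factorial_smul_choose r k
  have h3 : (descPochhammer ℤ (k + 1)).smeval r = (descPochhammer ℤ k).smeval r * (r - k) := by
    rw [descPochhammer_succ_right, mul_comm, Polynomial.smeval_mul, mul_comm]
    simp [Polynomial.smeval_sub, Polynomial.smeval_X, Polynomial.smeval_natCast]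
  rw [h1, h2, Nat.factorial_succ] at h3
  simp only [nsmul_eq_mul, Nat.cast_mul] at h3
  have h4 : (k.factorial : ℝ) ≠ 0 := by exact_mod_cast Nat.factorial_ne_zero k
  apply mul_left_cancel₀ h4
  push_cast at h3
  linarith

/-- For `k ≥ r` the recurrence reads `r |c_k| = k |c_k| - (k + 1) |c_{k+1}|` with `c_k = Ring.choose
r k`. The right side telescopes, so the tail sums from `N ≥ r` on are at most `N |c_N| / r`. -/
theorem Ring.summable_norm_choose {r : ℝ} (hr : 0 < r) :
    Summable (fun k => ‖Ring.choose r k‖) := by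
  obtain ⟨N, hN⟩ := exists_nat_ge r
  rw [← summable_nat_add_iff N]
  have key : ∀ k : ℕ, r * ‖Ring.choose r (k + N)‖ =
      (k + N : ℕ) * ‖Ring.choose r (k + N)‖ -
        (k + 1 + N : ℕ) * ‖Ring.choose r (k + 1 + N)‖ := by
    intro k
    have h := congrArg norm (Ring.choose_succ_mul r (k + N))
    have h0 : r - (k + N : ℕ) ≤ 0 := by
      push_cast
      linarith [(Nat.cast_nonneg k : (0 : ℝ) ≤ k)]
    have h1 : (0 : ℝ) ≤ (k + N : ℕ) + 1 := by positivity
    rw [norm_mul, norm_mul, Real.norm_of_nonneg h1, Real.norm_of_nonpos h0] at h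
    rw [show k + 1 + N = k + N + 1 by omega]
    push_cast at h ⊢
    linarith
  refine summable_of_sum_range_le (c := N * ‖Ring.choose r N‖ / r) (fun _ => norm_nonneg _) ?_
  intro n
  rw [le_div_iff₀ hr, mul_comm, Finset.mul_sum, Finset.sum_congr rfl fun k _ => key k,
    Finset.sum_range_sub']
  simp only [zero_add, tsub_le_iff_right, le_add_iff_nonneg_right]
  positivity

theorem hasSum_choose_mul_pow_of_abs_lt {x : ℝ} (hx : |x| < 1) (a : ℝ) :
    HasSum (fun k => Ring.choose a k * x ^ k) ((1 + x) ^ a) := by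
  have h := (Real.one_add_rpow_hasFPowerSeriesOnBall_zero (a := a)).hasSum (y := x)
    (by simpa [enorm_eq_nnnorm, ← NNReal.coe_lt_coe] using hx)
  simpa [binomialSeries, FormalMultilinearSeries.coeff_ofScalars, mul_comm] using h

/-- The binomial series with positive exponent, up to the left end point `-1`. -/
theorem hasSum_choose_mul_pow {a : ℝ} (ha : 0 < a) {x : ℝ} (h1 : -1 ≤ x) (h2 : x ≤ 0) :
    HasSum (fun k => Ring.choose a k * x ^ k) ((1 + x) ^ a) := by
  rcases h1.lt_or_eq with h | rfl
  · exact hasSum_choose_mul_pow_of_abs_lt (abs_lt.2 ⟨h, by linarith⟩) a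
  -- At the end point `-1`, an Abel-type argument: the series is continuous on `[-1, 1]` by the
  -- Weierstrass test, the power is continuous because `a > 0`, and the two agree on `(-1, 1)`.
  have hle : ∀ (k : ℕ) (y : ℝ), |y| ≤ 1 → ‖Ring.choose a k * y ^ k‖ ≤ ‖Ring.choose a k‖ := by
    intro k y hy
    rw [norm_mul, norm_pow]
    exact mul_le_of_le_one_right (norm_nonneg _) (pow_le_one₀ (norm_nonneg _) hy)
  have hs : Summable fun k => Ring.choose a k * (-1 : ℝ) ^ k :=
    Summable.of_norm_bounded (Ring.summable_norm_choose ha) fun k => hle k _ (by simp)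
  have hc : ContinuousOn (fun y : ℝ => ∑' k, Ring.choose a k * y ^ k) (Set.Icc (-1) 1) :=
    continuousOn_tsum (fun k => by fun_prop) (Ring.summable_norm_choose ha)
      fun k y hy => hle k y (abs_le.2 hy)
  have hd : Continuous (fun y : ℝ => (1 + y) ^ a) :=
    (continuous_const.add continuous_id).rpow_const fun _ => Or.inr ha.le
  have hsub : Set.Ioo (-1 : ℝ) 1 ⊆ Set.Icc (-1) 1 := Set.Ioo_subset_Icc_self
  have hne : (𝓝[Set.Ioo (-1 : ℝ) 1] (-1)).NeBot :=
    mem_closure_iff_nhdsWithin_neBot.1 (by rw [closure_Ioo (by norm_num)]; simp)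
  have e := tendsto_nhds_unique_of_eventuallyEq
    ((hc (-1) (by simp)).mono_left (nhdsWithin_mono _ hsub))
    (hd.continuousAt.mono_left nhdsWithin_le_nhds)
    (eventually_nhdsWithin_of_forall fun y (hy : y ∈ Set.Ioo (-1 : ℝ) 1) =>
      (hasSum_choose_mul_pow_of_abs_lt (abs_lt.2 hy) a).tsum_eq)
  have e' : ∑' k, Ring.choose a k * (-1 : ℝ) ^ k = (1 + -1) ^ a := e
  rw [← e']
  exact hs.hasSum

/-! ### The Fourier transform of the Cauchy density -/

open FourierTransform in
-- On each side of `0` the integrand is a pure exponential, with rates `b` and `c`. The two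
-- half-line integrals add up to `1/b - 1/c = (c - b) / (b c)`.
theorem fourier_exp_neg_mul_abs {a : ℝ} (ha : 0 < a) (w : ℝ) :
    𝓕 (fun x : ℝ => Complex.exp (-(a * |x|))) w =
      ((2 * a / (a ^ 2 + (2 * Real.pi * w) ^ 2) : ℝ) : ℂ) := by
  rw [Real.fourier_eq']
  set b : ℂ := a - 2 * Real.pi * w * Complex.I with hb
  set c : ℂ := -(a + 2 * Real.pi * w * Complex.I) with hc
  have hbr : 0 < b.re := by simpa [hb] using ha
  have hcr : c.re < 0 := by simpa [hc] using ha
  have e1 : Set.EqOn (fun v : ℝ => Complex.exp (↑(-2 * Real.pi * inner ℝ v w) * Complex.I) •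
      Complex.exp (-(a * |v|))) (fun v : ℝ => Complex.exp (b * v)) (Set.Iic 0) := by
    intro v hv
    simp only [smul_eq_mul, ← Complex.exp_add, abs_of_nonpos (Set.mem_Iic.1 hv), hb]
    congr 1
    simp
    ring
  have e2 : Set.EqOn (fun v : ℝ => Complex.exp (↑(-2 * Real.pi * inner ℝ v w) * Complex.I) •
      Complex.exp (-(a * |v|))) (fun v : ℝ => Complex.exp (c * v)) (Set.Ioi 0) := by
    intro v hv
    simp only [smul_eq_mul, ← Complex.exp_add, abs_of_pos (Set.mem_Ioi.1 hv), hc]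
    congr 1
    simp
    ring
  have hb0 : b ≠ 0 := fun h => by simp [h] at hbr
  have hc0 : c ≠ 0 := fun h => by simp [h] at hcr
  have hbc : -(b * c) = ((a ^ 2 + (2 * Real.pi * w) ^ 2 : ℝ) : ℂ) := by
    push_cast
    rw [hb, hc]
    linear_combination (-(2 * Real.pi * w) ^ 2 : ℂ) * Complex.I_sq
  have hadd : c - b = -(2 * a : ℝ) := by
    push_cast
    rw [hb, hc]
    ring
  rw [← intervalIntegral.integral_Iic_add_Ioi (b := 0)
      ((integrableOn_exp_mul_complex_Iic hbr 0).congr_fun e1.symm measurableSet_Iic)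
      ((integrableOn_exp_mul_complex_Ioi hcr 0).congr_fun e2.symm measurableSet_Ioi),
    setIntegral_congr_fun measurableSet_Iic e1, setIntegral_congr_fun measurableSet_Ioi e2,
    integral_exp_mul_complex_Iic hbr, integral_exp_mul_complex_Ioi hcr,
    Complex.ofReal_div, ← hbc, ← neg_neg ((2 * a : ℝ) : ℂ), ← hadd]
  simp
  field_simp
  ring

theorem integrable_div_sq_add_sq {a : ℝ} (ha : a ≠ 0) :
    Integrable (fun w : ℝ => a / (a ^ 2 + w ^ 2)) := by
  have h := (integrable_inv_one_add_sq.comp_mul_left' (R := a⁻¹) (inv_ne_zero ha)).const_mul a⁻¹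
  refine h.congr (Eventually.of_forall fun w => ?_)
  simp only
  field_simp

theorem integrable_exp_neg_mul_abs {a : ℝ} (ha : 0 < a) :
    Integrable (fun x : ℝ => Complex.exp (-(a * |x|))) := by
  rw [← integrableOn_univ, ← Set.Iic_union_Ioi (a := (0 : ℝ))]
  refine IntegrableOn.union ?_ ?_
  · refine (integrableOn_exp_mul_complex_Iic (a := a) (by simpa using ha) 0).congr_fun
      (fun v hv => ?_) measurableSet_Iic
    simp [abs_of_nonpos (Set.mem_Iic.1 hv)]
  · refine (integrableOn_exp_mul_complex_Ioi (a := -a) (by simpa using ha) 0).congr_fun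
      (fun v hv => ?_) measurableSet_Ioi
    simp [abs_of_pos (Set.mem_Ioi.1 hv)]

open FourierTransform in
-- Fourier inversion for `exp(-a|x|)`, followed by the substitution `w = 2πv` that removes the
-- factor `2π` from the frequency.
theorem integral_exp_mul_div_sq_add_sq {a : ℝ} (ha : 0 < a) (h : ℝ) :
    ∫ w : ℝ, Complex.exp (Complex.I * h * w) * ((a / (a ^ 2 + w ^ 2) : ℝ) : ℂ) =
      ((Real.pi * Real.exp (-(a * |h|)) : ℝ) : ℂ) := by
  set f : ℝ → ℂ := fun x => Complex.exp (-(a * |x|)) with hf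
  have hF : 𝓕 f = fun w : ℝ => ((2 * a / (a ^ 2 + (2 * Real.pi * w) ^ 2) : ℝ) : ℂ) :=
    funext fun w => fourier_exp_neg_mul_abs ha w
  have hFi : Integrable (𝓕 f) := by
    rw [hF]
    have := (((integrable_div_sq_add_sq ha.ne').comp_mul_left' (R := 2 * Real.pi)
      Real.two_pi_pos.ne').const_mul 2).ofReal (𝕜 := ℂ)
    refine this.congr (Eventually.of_forall fun w => ?_)
    simp [mul_div_assoc]
  have hinv := congrFun (Continuous.fourierInv_fourier_eq (f := f) (by fun_prop)
    (integrable_exp_neg_mul_abs ha) hFi) h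
  rw [Real.fourierInv_eq', hF] at hinv
  have hcv := Measure.integral_comp_mul_left
    (fun w : ℝ => Complex.exp (Complex.I * h * w) * ((a / (a ^ 2 + w ^ 2) : ℝ) : ℂ))
    (2 * Real.pi)
  have hE : (fun v : ℝ => Complex.exp (↑(2 * Real.pi * inner ℝ v h) * Complex.I) •
      ((2 * a / (a ^ 2 + (2 * Real.pi * v) ^ 2) : ℝ) : ℂ)) = fun v : ℝ =>
      2 * (Complex.exp (Complex.I * h * (2 * Real.pi * v : ℝ)) *
        ((a / (a ^ 2 + (2 * Real.pi * v) ^ 2) : ℝ) : ℂ)) := by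
    ext v
    have : Complex.I * h * (2 * Real.pi * v : ℝ) = ↑(2 * Real.pi * inner ℝ v h) * Complex.I := by
      simp
      ring
    rw [this, smul_eq_mul]
    push_cast
    ring
  rw [hE, integral_const_mul, hcv, abs_of_pos (inv_pos.2 Real.two_pi_pos)] at hinv
  simp only [Complex.real_smul, hf] at hinv
  push_cast at hinv ⊢
  rw [← hinv, ← mul_assoc, ← mul_assoc, mul_comm _ (2 : ℂ)]
  rw [show (2 * Real.pi * (2 * Real.pi : ℂ)⁻¹ : ℂ) = 1 by field_simp, one_mul]

/-- The previous formula for parameters of either sign. -/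
theorem integral_exp_mul_div_sq_add_sq_of_ne {a : ℝ} (ha : a ≠ 0) (h : ℝ) :
    ∫ w : ℝ, Complex.exp (Complex.I * h * w) * ((a / (a ^ 2 + w ^ 2) : ℝ) : ℂ) =
      ((SignType.sign a * (Real.pi * Real.exp (-(|a| * |h|))) : ℝ) : ℂ) := by
  rcases ha.lt_or_gt with h0 | h0
  · have := integral_exp_mul_div_sq_add_sq (neg_pos.2 h0) h
    rw [sign_neg h0, abs_of_neg h0]
    simp only [neg_sq, neg_div, Complex.ofReal_neg, mul_neg, integral_neg] at this ⊢
    rw [← neg_inj, this]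
    simp
  · rw [sign_pos h0, abs_of_pos h0]
    simpa using integral_exp_mul_div_sq_add_sq h0 h

/-- The absolute value is the kernel with parameter `|a|`, and its integral is the transform at `h =
0`. That the value does not depend on `a` is what allows termwise integration. -/
theorem integral_norm_div_sq_add_sq {a : ℝ} (ha : a ≠ 0) :
    ∫ w : ℝ, ‖a / (a ^ 2 + w ^ 2)‖ = Real.pi := by
  have h := integral_exp_mul_div_sq_add_sq (abs_pos.2 ha) 0
  simp only [Complex.ofReal_zero, mul_zero, zero_mul, Complex.exp_zero, one_mul, abs_zero,
    neg_zero, Real.exp_zero, mul_one, sq_abs] at h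
  rw [integral_complex_ofReal] at h
  rw [← Complex.ofReal_injective h]
  refine integral_congr_ae (Eventually.of_forall fun w => ?_)
  simp only
  rw [norm_div, Real.norm_eq_abs, Real.norm_of_nonneg (by positivity : 0 ≤ a ^ 2 + w ^ 2)]

/-! ### The Fourier transform of the spectral density -/

theorem natCast_sub_ne_zero {H : ℝ} (hH0 : 0 < H) (hH1 : H < 1) (k : ℕ) : (k : ℝ) - H ≠ 0 := by
  rcases Nat.eq_zero_or_pos k with rfl | hk
  · simp [hH0.ne']
  · have : (1 : ℝ) ≤ k := by exact_mod_cast hk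
    linarith

theorem min_le_abs_natCast_sub {H : ℝ} (k : ℕ) : min H (1 - H) ≤ |(k : ℝ) - H| := by
  rcases Nat.eq_zero_or_pos k with rfl | hk
  · simp [le_abs_self]
  · have : (1 : ℝ) ≤ k := by exact_mod_cast hk
    exact (min_le_right _ _).trans (le_trans (by linarith) (le_abs_self _))

theorem norm_div_sq_add_sq_le (a w : ℝ) : ‖a / (a ^ 2 + w ^ 2)‖ ≤ |a|⁻¹ := by
  rcases eq_or_ne a 0 with rfl | ha
  · simp
  have : 0 < |a| := abs_pos.2 ha
  rw [norm_div, Real.norm_eq_abs, Real.norm_of_nonneg (by positivity : 0 ≤ a ^ 2 + w ^ 2),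
    ← sq_abs a, div_le_iff₀ (by positivity)]
  field_simp
  nlinarith [sq_nonneg w]

/-- The binomial coefficients are summable, and the Cauchy factors are bounded uniformly in `k`
because `H` keeps the distance `min H (1 - H)` from the natural numbers. -/
theorem summable_spectralTerm {H : ℝ} (hH0 : 0 < H) (hH1 : H < 1) (w : ℝ) :
    Summable (spectralTerm H w) := by
  refine Summable.of_norm_bounded
    ((Ring.summable_norm_choose (by linarith : 0 < 2 * H)).mul_right (min H (1 - H))⁻¹) fun k => ?_
  have hm : 0 < min H (1 - H) := lt_min hH0 (by linarith)
  rw [spectralTerm, norm_mul, norm_mul, norm_zpow, norm_neg, norm_one, one_zpow, mul_one]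
  gcongr
  exact (norm_div_sq_add_sq_le ((k : ℝ) - H) w).trans (inv_anti₀ hm (min_le_abs_natCast_sub k))

/-- Rests on `1 - e^{-u} = 2 e^{-u/2} sinh(u/2)` for `u = |h|`. -/
theorem half_exp_mul_rpow (H h : ℝ) :
    1 / 2 * Real.exp (H * |h|) * (1 + -Real.exp (-|h|)) ^ (2 * H) =
      2 ^ (2 * H - 1) * |Real.sinh (h / 2)| ^ (2 * H) := by
  have h0 : 0 ≤ 1 + -Real.exp (-|h|) := by simp
  have e : |Real.sinh (h / 2)| = Real.exp (|h| / 2) * (1 + -Real.exp (-|h|)) * 2⁻¹ := by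
    rw [Real.abs_sinh, abs_div, abs_two, Real.sinh_eq, mul_add, mul_neg, ← Real.exp_add]
    ring_nf
  rw [e, Real.mul_rpow (by positivity) (by norm_num), Real.mul_rpow (by positivity) h0,
    ← Real.exp_mul, Real.inv_rpow (by norm_num), Real.rpow_sub (by norm_num), Real.rpow_one]
  have : (2 : ℝ) ^ (2 * H) ≠ 0 := by positivity
  field_simp

/-- The summands of the Fourier transform of the spectral density. -/
theorem spectral_summand {H : ℝ} (hH0 : 0 < H) (hH1 : H < 1) (h : ℝ) (k : ℕ) :
    1 / 2 * (Ring.choose (2 * H) k * (-1) ^ ((k : ℤ) - 1) *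
      (SignType.sign ((k : ℝ) - H) * Real.exp (-(|(k : ℝ) - H| * |h|)))) =
      (if k = 0 then Real.cosh (h * H) else 0) -
        1 / 2 * Real.exp (H * |h|) * (Ring.choose (2 * H) k * (-Real.exp (-|h|)) ^ k) := by
  -- The term `k = 0` equals `½ e^{-H|h|}`, whereas the binomial series would need `-½ e^{H|h|}`
  -- there; the difference is `cosh(hH)`.
  rcases Nat.eq_zero_or_pos k with rfl | hk
  · have : Real.cosh (h * H) = (Real.exp (H * |h|) + Real.exp (-(H * |h|))) / 2 := by
      rw [← Real.cosh_eq, ← Real.cosh_abs (h * H), abs_mul, abs_of_pos hH0, mul_comm]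
    simp [this, hH0, abs_of_pos hH0]
    ring
  · have h1 : (1 : ℝ) ≤ k := by exact_mod_cast hk
    have h2 : 0 < (k : ℝ) - H := by linarith
    have h3 : Real.exp (-(((k : ℝ) - H) * |h|)) = Real.exp (H * |h|) * Real.exp (-|h|) ^ k := by
      rw [← Real.exp_nat_mul, ← Real.exp_add]
      ring_nf
    rw [if_neg hk.ne', sign_pos h2, abs_of_pos h2, h3, neg_pow, zpow_sub_one₀ (by norm_num)]
    simp
    ring

theorem fourier_spectralDensity {H : ℝ} (hH0 : 0 < H) (hH1 : H < 1) (h : ℝ) :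
    ∫ w : ℝ, Complex.exp (Complex.I * h * w) * (spectralDensity H w : ℂ) =
      ((Real.cosh (h * H) - 2 ^ (2 * H - 1) * |Real.sinh (h / 2)| ^ (2 * H) : ℝ) : ℂ) := by
  set b : ℕ → ℝ := fun k => Ring.choose (2 * H) k * (-1) ^ ((k : ℤ) - 1) with hb
  have hbn : ∀ k, ‖b k‖ = ‖Ring.choose (2 * H) k‖ := fun k => by
    rw [hb, norm_mul, norm_zpow, norm_neg, norm_one, one_zpow, mul_one]
  set F : ℕ → ℝ → ℂ := fun k w => Complex.exp (Complex.I * h * w) * (spectralTerm H w k : ℂ)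
    with hF
  have hFeq : ∀ k, F k = fun w : ℝ => (b k : ℂ) * (Complex.exp (Complex.I * h * w) *
      ((((k : ℝ) - H) / (((k : ℝ) - H) ^ 2 + w ^ 2) : ℝ) : ℂ)) := by
    intro k
    ext w
    simp only [hF, spectralTerm, hb]
    push_cast
    ring
  have hne : ∀ w : ℝ, ‖Complex.exp (Complex.I * h * w)‖ = 1 := fun w => by
    rw [Complex.norm_exp]
    simp
  have hFn : ∀ k w, ‖F k w‖ = ‖b k‖ * ‖((k : ℝ) - H) / (((k : ℝ) - H) ^ 2 + w ^ 2)‖ := by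
    intro k w
    rw [hFeq]
    simp only [norm_mul, hne, one_mul, Complex.norm_real]
  have hFi : ∀ k, Integrable (F k) := by
    intro k
    rw [hFeq]
    refine Integrable.const_mul ?_ _
    refine (integrable_div_sq_add_sq (natCast_sub_ne_zero hH0 hH1 k)).ofReal.bdd_mul
      (c := 1) (by fun_prop) (Eventually.of_forall fun w => (hne w).le)
  have hFint : ∀ k, ∫ w, ‖F k w‖ = ‖Ring.choose (2 * H) k‖ * Real.pi := by
    intro k
    simp only [hFn, integral_const_mul, hbn,
      integral_norm_div_sq_add_sq (natCast_sub_ne_zero hH0 hH1 k)]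
  have hsum := hasSum_integral_of_summable_integral_norm hFi (by
    simp only [hFint]
    exact (Ring.summable_norm_choose (by linarith : 0 < 2 * H)).mul_right _)
  have hval : ∀ k, ∫ w, F k w = ((b k * (SignType.sign ((k : ℝ) - H) *
      (Real.pi * Real.exp (-(|(k : ℝ) - H| * |h|)))) : ℝ) : ℂ) := by
    intro k
    rw [hFeq, integral_const_mul,
      integral_exp_mul_div_sq_add_sq_of_ne (natCast_sub_ne_zero hH0 hH1 k)]
    push_cast
    ring
  -- The binomial series is taken at `x = -e^{-|h|}`, which reaches the end point `-1` when `h = 0`.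
  have hser := (hasSum_ite_eq (0 : ℕ) (Real.cosh (h * H))).sub
    ((hasSum_choose_mul_pow (by linarith : 0 < 2 * H) (x := -Real.exp (-|h|))
      (by simp) (by simp [Real.exp_nonneg])).mul_left (1 / 2 * Real.exp (H * |h|)))
  simp only [← spectral_summand hH0 hH1, half_exp_mul_rpow] at hser
  have hint : ∫ w : ℝ, Complex.exp (Complex.I * h * w) * (spectralDensity H w : ℂ) =
      ((1 / (2 * Real.pi) : ℝ) : ℂ) * ∫ w, ∑' k, F k w := by
    rw [← integral_const_mul]
    congr 1
    ext w
    simp only [hF, spectralDensity]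
    rw [tsum_mul_left, Complex.ofReal_mul, Complex.ofReal_tsum]
    ring
  rw [hint, ← hsum.tsum_eq]
  simp only [hval]
  rw [← Complex.ofReal_tsum, ← Complex.ofReal_mul, ← tsum_mul_left, ← hser.tsum_eq]
  congr 2
  ext k
  simp only [hb]
  field_simp

/-! ### The Lamperti transform of a stationary process -/

/-- For `u = log(t+h) - log t` one has `e^u = (t+h)/t` and `1 - e^{-u} = h/(t+h)`. Hence the `cosh`
part cancels the two squares, and the `sinh` part leaves `h^{2H}`. -/
theorem lamperti_increment_identity {H t h : ℝ} (ht : 0 < t) (hh : 0 < h) :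
    ((t + h) ^ H) ^ 2 + (t ^ H) ^ 2 - 2 * ((t + h) ^ H * t ^ H) *
      (Real.cosh ((Real.log (t + h) - Real.log t) * H) -
        2 ^ (2 * H - 1) * |Real.sinh ((Real.log (t + h) - Real.log t) / 2)| ^ (2 * H)) =
      (h ^ H) ^ 2 := by
  have hth : 0 < t + h := by linarith
  have hu : 0 ≤ Real.log (t + h) - Real.log t :=
    sub_nonneg.2 (Real.log_le_log ht (by linarith))
  have hexp : ∀ s : ℝ, Real.exp ((Real.log (t + h) - Real.log t) * s) = (t + h) ^ s / t ^ s := by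
    intro s
    rw [sub_mul, Real.exp_sub, Real.rpow_def_of_pos hth, Real.rpow_def_of_pos ht]
  have h1 : 1 + -Real.exp (-(Real.log (t + h) - Real.log t)) = h / (t + h) := by
    rw [← mul_neg_one (Real.log _ - _), hexp, Real.rpow_neg_one, Real.rpow_neg_one]
    field_simp
    ring
  have hsq : ∀ s : ℝ, 0 < s → s ^ (2 * H) = (s ^ H) ^ 2 := fun s hs => by
    rw [mul_comm, Real.rpow_mul hs.le, Real.rpow_two]
  rw [← half_exp_mul_rpow, abs_of_nonneg hu, h1, Real.div_rpow hh.le hth.le, hsq h hh,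
    hsq _ hth, Real.cosh_eq, Real.exp_neg, mul_comm H, hexp]
  have hA : (t + h) ^ H ≠ 0 := (Real.rpow_pos_of_pos hth _).ne'
  have hB : t ^ H ≠ 0 := (Real.rpow_pos_of_pos ht _).ne'
  field_simp
  ring

namespace IsCentredStationary

variable {Ω : Type u} [MeasurableSpace Ω] {P : Measure Ω} {X : ℝ → Ω → ℝ}

theorem isSelfSimilar_lamperti (hX : IsCentredStationary P X) {H : ℝ} (hH : 0 < H) :
    IsSelfSimilar P H (lamperti H X) := by
  refine ⟨hH, fun a n t => ?_⟩
  have h := (hX.stationary (Real.log a) n fun i => Real.log (t i)).comp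
    (u := fun (v : Fin n → ℝ) i => (a : ℝ) ^ H * ((t i : ℝ) ^ H * v i)) (by fun_prop)
  have e : (fun ω i => lamperti H X (a * t i) ω) =
      (fun (v : Fin n → ℝ) i => (a : ℝ) ^ H * ((t i : ℝ) ^ H * v i)) ∘
        fun ω i => X (Real.log (t i) + Real.log a) ω := by
    funext ω i
    simp only [lamperti, Function.comp_apply, Positive.val_mul]
    rw [Real.mul_rpow a.2.le (t i).2.le, Real.log_mul a.2.ne' (t i).2.ne', add_comm, mul_assoc]
  simp only [e]
  exact h

theorem integral_mul_shift (hX : IsCentredStationary P X) (s t τ : ℝ) :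
    ∫ ω, X (s + τ) ω * X (t + τ) ω ∂P = ∫ ω, X s ω * X t ω ∂P := by
  have h := ((hX.stationary τ 2 ![s, t]).comp (u := fun v : Fin 2 → ℝ => v 0 * v 1)
    (by fun_prop)).integral_eq
  simpa [Function.comp_def] using h

theorem integral_sq_eq (hX : IsCentredStationary P X) (t : ℝ) :
    ∫ ω, X t ω ^ 2 ∂P = ∫ ω, X 0 ω ^ 2 ∂P := by
  simpa [sq] using hX.integral_mul_shift 0 0 t

theorem variance_eq (hX : IsCentredStationary P X) (t : ℝ) :
    variance (X t) P = ∫ ω, X 0 ω ^ 2 ∂P := by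
  rw [variance_of_integral_eq_zero (hX.memLp t).aemeasurable (hX.centred t), hX.integral_sq_eq]

theorem integral_mul_eq [IsProbabilityMeasure P] (hX : IsCentredStationary P X)
    (h0 : correlationFunction P X 0 ≠ 0) (s t : ℝ) : ∫ ω, X s ω * X t ω ∂P =
      (∫ ω, X 0 ω ^ 2 ∂P) * correlationFunction P X (s - t) := by
  -- With zero variance the quotient defining the correlation is `0` by convention, contrary to
  -- `h0`; so the variance can be cancelled below.
  have hv : ∫ ω, X 0 ω ^ 2 ∂P ≠ 0 := by
    intro h
    exact h0 (by simp [correlationFunction, hX.variance_eq, h])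
  have h := hX.integral_mul_shift (s - t) 0 t
  rw [sub_add_cancel, zero_add] at h
  rw [h, correlationFunction, hX.variance_eq, hX.variance_eq,
    Real.mul_self_sqrt (integral_nonneg fun _ => sq_nonneg _), mul_div_cancel₀ _ hv,
    covariance_eq_sub (hX.memLp _) (hX.memLp _), hX.centred]
  simp

theorem hasSecondOrderStationaryIncrements_lamperti [IsProbabilityMeasure P]
    (hX : IsCentredStationary P X) {H : ℝ} (hH : 0 < H) (hρ : ∀ h : ℝ, correlationFunction P X h =
      Real.cosh (h * H) - 2 ^ (2 * H - 1) * |Real.sinh (h / 2)| ^ (2 * H)) :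
    HasSecondOrderStationaryIncrements P (lamperti H X) := by
  refine ⟨fun t => (hX.memLp _).const_mul _, fun t h => ?_⟩
  have h0 : correlationFunction P X 0 ≠ 0 := by
    rw [hρ]
    simp [Real.zero_rpow (mul_ne_zero two_ne_zero hH.ne')]
  simp only [lamperti, Positive.coe_add]
  set a : ℝ := ((t : ℝ) + h) ^ H
  set b : ℝ := (t : ℝ) ^ H
  set r := Real.log ((t : ℝ) + h)
  set s := Real.log (t : ℝ)
  have i1 : Integrable (fun ω => a ^ 2 * X r ω ^ 2) P := (hX.memLp _).integrable_sq.const_mul _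
  have i2 : Integrable (fun ω => b ^ 2 * X s ω ^ 2) P := (hX.memLp _).integrable_sq.const_mul _
  have i3 : Integrable (fun ω => 2 * (a * b) * (X r ω * X s ω)) P :=
    ((hX.memLp r).integrable_mul (hX.memLp s)).const_mul _
  have e : (fun ω => (a * X r ω - b * X s ω) ^ 2) = fun ω =>
      a ^ 2 * X r ω ^ 2 + b ^ 2 * X s ω ^ 2 - 2 * (a * b) * (X r ω * X s ω) := by
    ext ω
    ring
  have key := lamperti_increment_identity (H := H) t.2 h.2
  rw [← hρ] at key
  simp only [mul_pow]
  rw [e, integral_sub (by exact i1.add i2) i3, integral_add i1 i2]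
  simp only [integral_const_mul, hX.integral_sq_eq r, hX.integral_sq_eq s,
    hX.integral_sq_eq (Real.log h), hX.integral_mul_eq h0, ← key]
  ring

end IsCentredStationary

theorem HasSpectralDensity.correlationFunction_eq {Ω : Type u} [MeasurableSpace Ω]
    {P : Measure Ω} {X : ℝ → Ω → ℝ} {H : ℝ} (hH0 : 0 < H) (hH1 : H < 1)
    (hγ : HasSpectralDensity P X (spectralDensity H)) (h : ℝ) : correlationFunction P X h =
      Real.cosh (h * H) - 2 ^ (2 * H - 1) * |Real.sinh (h / 2)| ^ (2 * H) :=
  Complex.ofReal_injective ((hγ.correlation_eq h).trans (fourier_spectralDensity hH0 hH1 h))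

/-! ### Gaussian random measures -/

namespace IsGaussianRandomMeasure

variable {Ω : Type u} [MeasurableSpace Ω] {P : Measure Ω} {S : Type*} [MeasurableSpace S]
  {c : Measure S} {W : FiniteSets c → Ω → ℝ}

theorem hasLaw (hW : IsGaussianRandomMeasure P c W) (A : FiniteSets c) :
    HasLaw (W A) (gaussianReal 0 (c A.1).toNNReal) P :=
  ⟨(hW.measurable A).aemeasurable, hW.law A⟩

theorem memLp (hW : IsGaussianRandomMeasure P c W) (A : FiniteSets c) : MemLp (W A) 2 P := by
  have h := memLp_id_gaussianReal' (μ := 0) (v := (c A.1).toNNReal) 2 (by simp)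
  rw [← hW.law A, memLp_map_measure_iff (by fun_prop) (hW.measurable A).aemeasurable] at h
  exact h

theorem integral_eq_zero (hW : IsGaussianRandomMeasure P c W) (A : FiniteSets c) :
    ∫ ω, W A ω ∂P = 0 := by
  rw [(hW.hasLaw A).integral_eq]
  exact integral_id_gaussianReal

theorem integral_sq (hW : IsGaussianRandomMeasure P c W) (A : FiniteSets c) :
    ∫ ω, W A ω ^ 2 ∂P = c.real A.1 := by
  rw [← variance_of_integral_eq_zero (hW.measurable A).aemeasurable (hW.integral_eq_zero A),
    (hW.hasLaw A).variance_eq, variance_id_gaussianReal]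
  rfl

theorem ae_eq_zero_of_eq_empty (hW : IsGaussianRandomMeasure P c W) {A : FiniteSets c}
    (hA : A.1 = ∅) : W A =ᵐ[P] 0 := by
  have h := hW.law A
  rw [hA, measure_empty, ENNReal.toNNReal_zero, gaussianReal_zero_var] at h
  have h2 : ∀ᵐ x ∂(P.map (W A)), x = 0 := by rw [h]; simp
  exact ae_of_ae_map (hW.measurable A).aemeasurable h2

/-- The extension of a finite family of sets to a sequence, by empty sets. -/
noncomputable def extendByEmpty {ι : Type*} [Fintype ι] (A : ι → FiniteSets c) (k : ℕ) :
    FiniteSets c :=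
  if h : k < Fintype.card ι then A ((Fintype.equivFin ι).symm ⟨k, h⟩)
  else ⟨∅, MeasurableSet.empty, by simp⟩

theorem extendByEmpty_equivFin {ι : Type*} [Fintype ι] (A : ι → FiniteSets c) (i : ι) :
    extendByEmpty A (Fintype.equivFin ι i) = A i := by
  simp [extendByEmpty]

theorem pairwise_disjoint_extendByEmpty {ι : Type*} [Fintype ι] {A : ι → FiniteSets c}
    (hA : Pairwise fun i j => Disjoint (A i).1 (A j).1) :
    Pairwise fun i j => Disjoint (extendByEmpty A i).1 (extendByEmpty A j).1 := by
  intro i j hij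
  unfold extendByEmpty
  split_ifs with h1 h2
  · refine hA fun h => hij ?_
    simpa using (Fintype.equivFin ι).symm.injective h
  all_goals simp

/-- Padding with empty sets keeps disjointness, so the axiom for sequences covers finite families.
-/
theorem iIndepFun_of_disjoint (hW : IsGaussianRandomMeasure P c W) {ι : Type*} [Fintype ι]
    {A : ι → FiniteSets c} (hA : Pairwise fun i j => Disjoint (A i).1 (A j).1) :
    iIndepFun (fun i => W (A i)) P := by
  have h := (hW.indep _ (pairwise_disjoint_extendByEmpty hA)).precomp
    (g := fun i : ι => (Fintype.equivFin ι i : ℕ))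
    (Fin.val_injective.comp (Fintype.equivFin ι).injective)
  simpa only [extendByEmpty_equivFin] using h

/-- The padding sets carry a Gaussian variable of variance `0`, so almost surely the partial sums in
the additivity axiom are constant from `Fintype.card ι` on. -/
theorem ae_eq_sum (hW : IsGaussianRandomMeasure P c W) {ι : Type*} [Fintype ι]
    {A : ι → FiniteSets c} (hA : Pairwise fun i j => Disjoint (A i).1 (A j).1)
    {B : FiniteSets c} (hB : B.1 = ⋃ i, (A i).1) : W B =ᵐ[P] fun ω => ∑ i, W (A i) ω := by
  have hB' : B.1 = ⋃ k, (extendByEmpty A k).1 := by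
    rw [hB]
    refine Set.Subset.antisymm (Set.iUnion_subset fun i => ?_) (Set.iUnion_subset fun k => ?_)
    · rw [← extendByEmpty_equivFin A i]
      exact Set.subset_iUnion (fun k => (extendByEmpty A k).1) _
    · unfold extendByEmpty
      split_ifs with h
      · exact Set.subset_iUnion (fun i => (A i).1) _
      · exact Set.empty_subset _
  have hz : ∀ᵐ ω ∂P, ∀ k, Fintype.card ι ≤ k → W (extendByEmpty A k) ω = 0 := by
    rw [ae_all_iff]
    intro k
    by_cases hk : Fintype.card ι ≤ k
    · filter_upwards [hW.ae_eq_zero_of_eq_empty (A := extendByEmpty A k)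
        (by rw [extendByEmpty, dif_neg (by omega)])] with ω hω _ using hω
    · exact Eventually.of_forall fun ω h => absurd h hk
  filter_upwards [hW.additive _ B (pairwise_disjoint_extendByEmpty hA) hB', hz] with ω h1 h2
  refine tendsto_nhds_unique h1 (tendsto_const_nhds.congr' ?_)
  filter_upwards [eventually_ge_atTop (Fintype.card ι)] with n hn
  rw [← Finset.sum_subset (Finset.range_mono hn)
    fun k _ hk => h2 k (by simpa using hk), Finset.sum_range]
  refine Fintype.sum_equiv (Fintype.equivFin ι) _ _ fun i => ?_
  rw [extendByEmpty_equivFin]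

theorem ae_eq_inter_add_diff (hW : IsGaussianRandomMeasure P c W) (A B : FiniteSets c)
    (C D : FiniteSets c) (hC : C.1 = A.1 ∩ B.1) (hD : D.1 = A.1 \ B.1) :
    W A =ᵐ[P] fun ω => W C ω + W D ω := by
  have h := hW.ae_eq_sum (A := fun b : Bool => bif b then C else D) (B := A)
    (by
      have : Disjoint C.1 D.1 := by
        rw [hC, hD]
        exact Set.disjoint_sdiff_right.mono_left Set.inter_subset_right
      rintro (_ | _) (_ | _) hij <;> simp_all [disjoint_comm])
    (by
      have h : A.1 = C.1 ∪ D.1 := by rw [hC, hD, Set.inter_union_sdiff]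
      rw [h, Set.union_eq_iUnion]
      exact Set.iUnion_congr fun b => by cases b <;> rfl)
  filter_upwards [h] with ω hω
  simpa using hω

theorem integral_mul_of_disjoint (hW : IsGaussianRandomMeasure P c W) {A B : FiniteSets c}
    (hAB : Disjoint A.1 B.1) : ∫ ω, W A ω * W B ω ∂P = 0 := by
  have h := hW.iIndepFun_of_disjoint (A := fun b : Bool => bif b then A else B) (by
    rintro (_ | _) (_ | _) hij <;> simp_all [disjoint_comm])
  have h2 := (h.indepFun (i := true) (j := false) (by simp)).integral_fun_mul_eq_mul_integral
    (hW.measurable _).aestronglyMeasurable (hW.measurable _).aestronglyMeasurable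
  simpa [hW.integral_eq_zero] using h2

/-- Split both sets along `A ∩ B`. Values on disjoint sets are independent and centred, so only the
square of the common part contributes. -/
theorem integral_mul (hW : IsGaussianRandomMeasure P c W) (A B : FiniteSets c) :
    ∫ ω, W A ω * W B ω ∂P = c.real (A.1 ∩ B.1) := by
  have hfin : ∀ {T : Set S} (A : FiniteSets c), T ⊆ A.1 → c T < ∞ :=
    fun A h => (measure_mono h).trans_lt A.2.2
  let C : FiniteSets c := ⟨A.1 ∩ B.1, A.2.1.inter B.2.1, hfin A Set.inter_subset_left⟩
  let D : FiniteSets c := ⟨A.1 \ B.1, A.2.1.diff B.2.1, hfin A Set.sdiff_subset⟩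
  let E : FiniteSets c := ⟨B.1 \ A.1, B.2.1.diff A.2.1, hfin B Set.sdiff_subset⟩
  have hCE : Disjoint C.1 E.1 := Set.disjoint_sdiff_right.mono_left Set.inter_subset_left
  have hDC : Disjoint D.1 C.1 := Set.disjoint_sdiff_left.mono_right Set.inter_subset_right
  have hDE : Disjoint D.1 E.1 := Set.disjoint_sdiff_right.mono_left Set.sdiff_subset
  have hI : ∀ A B : FiniteSets c, Integrable (fun ω => W A ω * W B ω) P :=
    fun A B => (hW.memLp A).integrable_mul (hW.memLp B)
  have e : (fun ω => W A ω * W B ω) =ᵐ[P] fun ω =>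
      (W C ω * W C ω + W C ω * W E ω) + (W D ω * W C ω + W D ω * W E ω) := by
    filter_upwards [hW.ae_eq_inter_add_diff A B C D rfl rfl,
      hW.ae_eq_inter_add_diff B A C E (Set.inter_comm _ _) rfl] with ω h1 h2
    rw [h1, h2]
    ring
  rw [integral_congr_ae e, integral_add (by exact (hI C C).add (hI C E))
      (by exact (hI D C).add (hI D E)),
    integral_add (hI _ _) (hI _ _), integral_add (hI _ _) (hI _ _),
    hW.integral_mul_of_disjoint hCE, hW.integral_mul_of_disjoint hDC,
    hW.integral_mul_of_disjoint hDE]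
  simpa [sq] using hW.integral_sq C

end IsGaussianRandomMeasure

/-! ### Invariance under measure preserving maps -/

/-- The atom `{z | ∀ i, z ∈ A i ↔ i ∈ T}` of the algebra generated by finitely many sets. -/
def FiniteSets.atom {S : Type*} [MeasurableSpace S] {c : Measure S} {ι : Type*} [Fintype ι]
    (A : ι → FiniteSets c) (T : {T : Set ι // T.Nonempty}) : FiniteSets c :=
  ⟨{z | ∀ i, z ∈ (A i).1 ↔ i ∈ T.1}, by
    classical
    simp only [Set.ofPred_forall]
    refine MeasurableSet.iInter fun i => ?_
    by_cases h : i ∈ T.1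
    · simpa [h] using (A i).2.1
    · simp only [h, iff_false]
      exact (A i).2.1.compl, by
    -- Nonemptiness of `T` excludes the complement of the union of all `A i`, whose measure may be
    -- infinite.
    obtain ⟨i, hi⟩ := T.2
    exact (measure_mono fun z (hz : ∀ i, z ∈ (A i).1 ↔ i ∈ T.1) => (hz i).2 hi).trans_lt (A i).2.2⟩

/-- The preimage of a set of finite measure under a measure preserving map. -/
def FiniteSets.preimage {S : Type*} [MeasurableSpace S] {c : Measure S} {θ : S → S}
    (hθ : MeasurePreserving θ c c) (A : FiniteSets c) : FiniteSets c :=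
  ⟨θ ⁻¹' A.1, hθ.measurable A.2.1, by
    rw [hθ.measure_preimage A.2.1.nullMeasurableSet]
    exact A.2.2⟩

namespace IsGaussianRandomMeasure

variable {Ω : Type u} [MeasurableSpace Ω] {P : Measure Ω} {S : Type*} [MeasurableSpace S]
  {c : Measure S} {W : FiniteSets c → Ω → ℝ} {ι : Type*} [Fintype ι]

theorem pairwise_disjoint_atom (A : ι → FiniteSets c) :
    Pairwise fun T T' => Disjoint (FiniteSets.atom A T).1 (FiniteSets.atom A T').1 := by
  intro T T' h
  refine Set.disjoint_left.2 fun z (hz : ∀ i, z ∈ (A i).1 ↔ i ∈ T.1)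
    (hz' : ∀ i, z ∈ (A i).1 ↔ i ∈ T'.1) => h ?_
  ext i
  rw [← hz, ← hz']

open scoped Classical in
theorem ae_eq_sum_atom (hW : IsGaussianRandomMeasure P c W) (A : ι → FiniteSets c) (i : ι) :
    W (A i) =ᵐ[P] fun ω => ∑ T, if i ∈ T.1 then W (FiniteSets.atom A T) ω else 0 := by
  have h := hW.ae_eq_sum (A := fun T : {T : {T : Set ι // T.Nonempty} // i ∈ T.1} =>
      FiniteSets.atom A T.1) (B := A i)
    (fun T T' h => pairwise_disjoint_atom A fun e => h (Subtype.ext e)) (by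
      ext z
      simp only [Set.mem_iUnion]
      refine ⟨fun hz => ⟨⟨⟨{j | z ∈ (A j).1}, i, hz⟩, hz⟩, fun j => Iff.rfl⟩, ?_⟩
      rintro ⟨T, hT⟩
      exact (hT i).2 T.2)
  filter_upwards [h] with ω hω
  rw [hω, ← Finset.sum_filter]
  exact (Finset.sum_subtype _ (by simp) fun T => W (FiniteSets.atom A T) ω).symm

/-- The values on the atoms are independent Gaussians whose variances `θ` preserves, and the atoms
of the preimages are the preimages of the atoms. The values on the `A i` are the same linear
function of the atom values on both sides. -/
theorem identDistrib_preimage (hW : IsGaussianRandomMeasure P c W) {θ : S → S}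
    (hθ : MeasurePreserving θ c c) (A : ι → FiniteSets c) :
    IdentDistrib (fun ω i => W (A i) ω) (fun ω i => W ((A i).preimage hθ) ω) P P := by
  classical
  have hat : ∀ T, FiniteSets.atom (fun i => (A i).preimage hθ) T =
      (FiniteSets.atom A T).preimage hθ := fun T => rfl
  have h1 : IdentDistrib (fun ω T => W (FiniteSets.atom A T) ω)
      (fun ω T => W (FiniteSets.atom (fun i => (A i).preimage hθ) T) ω) P P := by
    refine IdentDistrib.pi (fun T => ⟨(hW.measurable _).aemeasurable,
      (hW.measurable _).aemeasurable, ?_⟩)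
      (hW.iIndepFun_of_disjoint (pairwise_disjoint_atom A))
      (hW.iIndepFun_of_disjoint (pairwise_disjoint_atom _))
    rw [hW.law, hW.law, hat]
    congr 2
    exact (hθ.measure_preimage (FiniteSets.atom A T).2.1.nullMeasurableSet).symm
  have h2 := h1.comp (u := fun (w : {T : Set ι // T.Nonempty} → ℝ) (i : ι) =>
    ∑ T, if i ∈ T.1 then w T else 0) (by
      refine measurable_pi_lambda _ fun i => Finset.measurable_sum _ fun T _ => ?_
      split_ifs
      · exact measurable_pi_apply T
      · exact measurable_const)
  have hm : ∀ A : ι → FiniteSets c, AEMeasurable (fun ω i => W (A i) ω) P := fun A =>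
    (measurable_pi_lambda _ fun i => hW.measurable (A i)).aemeasurable
  have hae : ∀ A : ι → FiniteSets c, (fun ω i => W (A i) ω) =ᵐ[P] fun ω i =>
      ∑ T, if i ∈ T.1 then W (FiniteSets.atom A T) ω else 0 := by
    intro A
    filter_upwards [ae_all_iff.2 fun i => hW.ae_eq_sum_atom A i] with ω hω
    exact funext hω
  exact ((IdentDistrib.of_ae_eq (hm _) (hae A)).trans h2).trans
    (IdentDistrib.of_ae_eq (hm _) (hae _)).symm

end IsGaussianRandomMeasure

/-! ### The isometry for simple integrands -/

theorem MeasureTheory.MemLp.eLpNorm_eq_of_integral_sq_eq {α β : Type*} [MeasurableSpace α]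
    [MeasurableSpace β] {μ : Measure α} {ν : Measure β} {f : α → ℝ} {g : β → ℝ}
    (hf : MemLp f 2 μ) (hg : MemLp g 2 ν) (h : ∫ x, f x ^ 2 ∂μ = ∫ x, g x ^ 2 ∂ν) :
    eLpNorm f 2 μ = eLpNorm g 2 ν := by
  rw [hf.eLpNorm_eq_integral_rpow_norm (by simp) (by simp),
    hg.eLpNorm_eq_integral_rpow_norm (by simp) (by simp)]
  simp [h]

theorem integral_sum_sq {α ι : Type*} [MeasurableSpace α] {μ : Measure α} [Fintype ι]
    {f : ι → α → ℝ} (hf : ∀ i, MemLp (f i) 2 μ) :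
    ∫ x, (∑ i, f i x) ^ 2 ∂μ = ∑ i, ∑ j, ∫ x, f i x * f j x ∂μ := by
  have h : ∀ i j, Integrable (fun x => f i x * f j x) μ := fun i j => (hf i).integrable_mul (hf j)
  simp only [sq, Finset.sum_mul_sum]
  rw [integral_finsetSum _ fun i _ => integrable_finsetSum _ fun j _ => h i j]
  exact Finset.sum_congr rfl fun i _ => integral_finsetSum _ fun j _ => h i j

namespace IsGaussianRandomMeasure

variable {Ω : Type u} [MeasurableSpace Ω] {P : Measure Ω} {S : Type*} [MeasurableSpace S]
  {c : Measure S} {W : FiniteSets c → Ω → ℝ} {ι : Type*} [Fintype ι]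
  {E : Type*} [MeasurableSpace E] {Z : Ω → E}

theorem memLp_mul (hW : IsGaussianRandomMeasure P c W) (hZ : Measurable Z) (A : FiniteSets c)
    {F : E → ℝ} (hF : Measurable F) {C : ℝ} (hC : ∀ x, |F x| ≤ C) :
    MemLp (fun ω => F (Z ω) * W A ω) 2 P := by
  refine ((hW.memLp A).const_mul C).of_le
    ((hF.comp hZ).mul (hW.measurable A)).aestronglyMeasurable (Eventually.of_forall fun ω => ?_)
  rw [norm_mul, norm_mul]
  exact mul_le_mul_of_nonneg_right ((hC _).trans (le_abs_self C)) (norm_nonneg _)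

theorem integral_mul_mul (hW : IsGaussianRandomMeasure P c W) (hZ : Measurable Z)
    (hind : IndepFun Z (fun ω A => W A ω) P) {f : E → ℝ} (hf : Measurable f)
    {g : (FiniteSets c → ℝ) → ℝ} (hg : Measurable g) :
    ∫ ω, f (Z ω) * g (fun A => W A ω) ∂P =
      (∫ ω, f (Z ω) ∂P) * ∫ ω, g (fun A => W A ω) ∂P :=
  hind.integral_fun_comp_mul_comp hZ.aemeasurable
    (measurable_pi_lambda _ fun A => hW.measurable A).aemeasurable
    hf.aestronglyMeasurable hg.aestronglyMeasurable

theorem integral_sum_eq_zero (hW : IsGaussianRandomMeasure P c W) [IsProbabilityMeasure P]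
    (hZ : Measurable Z) (hind : IndepFun Z (fun ω A => W A ω) P) (A : ι → FiniteSets c)
    {F : ι → E → ℝ} (hF : ∀ i, Measurable (F i)) (hC : ∀ i, ∃ C, ∀ x, |F i x| ≤ C) :
    ∫ ω, ∑ i, F i (Z ω) * W (A i) ω ∂P = 0 := by
  rw [integral_finsetSum]
  · refine Finset.sum_eq_zero fun i _ => ?_
    rw [hW.integral_mul_mul hZ hind (hF i) (g := fun w => w (A i)) (measurable_pi_apply _),
      hW.integral_eq_zero, mul_zero]
  · intro i _
    obtain ⟨C, hC⟩ := hC i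
    exact (hW.memLp_mul hZ (A i) (hF i) hC).integrable one_le_two

theorem memLp_indicator [IsProbabilityMeasure P] [SigmaFinite c] (hZ : Measurable Z)
    (A : FiniteSets c) {F : E → ℝ} (hF : Measurable F) {C : ℝ} (hC : ∀ x, |F x| ≤ C) :
    MemLp (fun q : S × Ω => A.1.indicator (fun _ => F (Z q.2)) q.1) 2 (c.prod P) := by
  have h := memLp_indicator_const (μ := c.prod P) 2 (A.2.1.prod MeasurableSet.univ) C
    (Or.inr (by simpa using A.2.2.ne))
  have hm : Measurable (fun q : S × Ω => A.1.indicator (fun _ => F (Z q.2)) q.1) :=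
    ((hF.comp hZ).comp measurable_snd).indicator (measurable_fst A.2.1)
  refine h.of_le hm.aestronglyMeasurable (Eventually.of_forall fun q => ?_)
  by_cases hq : q.1 ∈ A.1
  · simpa [hq, Set.indicator] using (hC _).trans (le_abs_self C)
  · simp [hq]

/-- The isometry for simple integrands with coefficients that are independent of `W`. -/
theorem eLpNorm_sum_mul (hW : IsGaussianRandomMeasure P c W) [IsProbabilityMeasure P]
    [SigmaFinite c] (hZ : Measurable Z) (hind : IndepFun Z (fun ω A => W A ω) P)
    (A : ι → FiniteSets c) {F : ι → E → ℝ} (hF : ∀ i, Measurable (F i))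
    (hC : ∀ i, ∃ C, ∀ x, |F i x| ≤ C) :
    eLpNorm (fun ω => ∑ i, F i (Z ω) * W (A i) ω) 2 P =
      eLpNorm (fun q : S × Ω => ∑ i, (A i).1.indicator (fun _ => F i (Z q.2)) q.1) 2
        (c.prod P) := by
  choose C hC using hC
  have m1 : ∀ i, MemLp (fun ω => F i (Z ω) * W (A i) ω) 2 P :=
    fun i => hW.memLp_mul hZ (A i) (hF i) (hC i)
  have m2 : ∀ i, MemLp (fun q : S × Ω => (A i).1.indicator (fun _ => F i (Z q.2)) q.1) 2
      (c.prod P) := fun i => memLp_indicator hZ (A i) (hF i) (hC i)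
  refine MemLp.eLpNorm_eq_of_integral_sq_eq (memLp_finsetSum _ fun i _ => m1 i)
    (memLp_finsetSum _ fun i _ => m2 i) ?_
  -- Both squared norms expand into the same double sum, with entries `E[F_i F_j] c(A_i ∩ A_j)`: by
  -- independence and the covariance of `W` here, by Fubini in `e2`.
  have e1 : ∀ i j, ∫ ω, (F i (Z ω) * W (A i) ω) * (F j (Z ω) * W (A j) ω) ∂P =
      (∫ ω, F i (Z ω) * F j (Z ω) ∂P) * c.real ((A i).1 ∩ (A j).1) := by
    intro i j
    have h := hW.integral_mul_mul hZ hind (f := fun x => F i x * F j x) ((hF i).mul (hF j))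
      (g := fun w => w (A i) * w (A j)) ((measurable_pi_apply _).mul (measurable_pi_apply _))
    rw [← hW.integral_mul, ← h]
    congr 1
    ext ω
    ring
  have e2 : ∀ i j, ∫ q : S × Ω, (A i).1.indicator (fun _ => F i (Z q.2)) q.1 *
      (A j).1.indicator (fun _ => F j (Z q.2)) q.1 ∂(c.prod P) =
      (∫ ω, F i (Z ω) * F j (Z ω) ∂P) * c.real ((A i).1 ∩ (A j).1) := by
    intro i j
    have h := integral_prod_mul (μ := c) (ν := P)
      (((A i).1 ∩ (A j).1).indicator fun _ => (1 : ℝ)) fun ω => F i (Z ω) * F j (Z ω)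
    rw [integral_indicator_const _ ((A i).2.1.inter (A j).2.1), smul_eq_mul, mul_one,
      mul_comm] at h
    rw [← h]
    congr 1
    ext q
    by_cases h1 : q.1 ∈ (A i).1 <;> by_cases h2 : q.1 ∈ (A j).1 <;> simp [h1, h2]
  rw [integral_sum_sq m1, integral_sum_sq m2]
  exact Finset.sum_congr rfl fun i _ => Finset.sum_congr rfl fun j _ => (e1 i j).trans (e2 i j).symm

/-- The isometry for the difference of two simple integrands, whose coefficients are functions
of the same random element. -/
theorem eLpNorm_sum_sub_sum (hW : IsGaussianRandomMeasure P c W) [IsProbabilityMeasure P]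
    [SigmaFinite c] (hZ : Measurable Z) (hind : IndepFun Z (fun ω A => W A ω) P)
    {κ : Type*} [Fintype κ] (A : ι → FiniteSets c) (B : κ → FiniteSets c)
    {F : ι → E → ℝ} (hF : ∀ i, Measurable (F i)) (hFb : ∀ i, ∃ C, ∀ x, |F i x| ≤ C)
    {G : κ → E → ℝ} (hG : ∀ i, Measurable (G i)) (hGb : ∀ i, ∃ C, ∀ x, |G i x| ≤ C) :
    eLpNorm (fun ω => ∑ i, F i (Z ω) * W (A i) ω - ∑ i, G i (Z ω) * W (B i) ω) 2 P =
      eLpNorm (fun q : S × Ω => ∑ i, (A i).1.indicator (fun _ => F i (Z q.2)) q.1 -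
        ∑ i, (B i).1.indicator (fun _ => G i (Z q.2)) q.1) 2 (c.prod P) := by
  -- The difference is a single simple integrand indexed by `ι ⊕ κ`.
  have h := hW.eLpNorm_sum_mul hZ hind (Sum.elim A B)
    (F := Sum.elim F fun i x => -G i x)
    (by rintro (i | i); exacts [hF i, (hG i).neg])
    (by rintro (i | i); exacts [hFb i, by simpa using hGb i])
  have hind : ∀ (T : Set S) (a : ℝ) (z : S),
      T.indicator (fun _ => -a) z = -T.indicator (fun _ => a) z :=
    fun T a z => congrFun (Set.indicator_neg T fun _ => a) z
  simpa [Fintype.sum_sum_type, hind, sub_eq_add_neg] using h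

/-- Simple integrals have the same joint law after the sets have been transformed by a measure
preserving map, and the coefficients by a change of the random element that keeps its law. -/
theorem identDistrib_mul (hW : IsGaussianRandomMeasure P c W) [IsProbabilityMeasure P]
    {Z' : Ω → E} (hZ : IdentDistrib Z Z' P P) (hind : IndepFun Z (fun ω A => W A ω) P)
    (hind' : IndepFun Z' (fun ω A => W A ω) P) {θ : S → S} (hθ : MeasurePreserving θ c c)
    (A : ι → FiniteSets c) {F : ι → E → ℝ} (hF : ∀ i, Measurable (F i)) :
    IdentDistrib (fun ω i => F i (Z ω) * W (A i) ω)
      (fun ω i => F i (Z' ω) * W ((A i).preimage hθ) ω) P P := by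
  have hF' : Measurable fun x i => F i x := measurable_pi_lambda _ hF
  have h1 := hZ.comp hF'
  have hsel : ∀ A : ι → FiniteSets c, Measurable fun (w : FiniteSets c → ℝ) i => w (A i) :=
    fun A => measurable_pi_lambda _ fun i => measurable_pi_apply _
  -- On each side the coefficients are independent of the values of `W`, so equal marginal laws give
  -- equal joint laws.
  exact (h1.prodMk (hW.identDistrib_preimage hθ A) (hind.comp hF' (hsel A))
    (hind'.comp hF' (hsel _))).comp (u := fun (p : (ι → ℝ) × (ι → ℝ)) i => p.1 i * p.2 i)
    (by fun_prop)

end IsGaussianRandomMeasure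

/-! ### Limits of identically distributed sequences -/

theorem eLpNorm_pi_le_sum {Ω : Type*} [MeasurableSpace Ω] {P : Measure Ω} {n : ℕ}
    {V : Fin n → Ω → ℝ} (hV : ∀ i, AEStronglyMeasurable (V i) P) :
    eLpNorm (fun ω i => V i ω) 2 P ≤ ∑ i, eLpNorm (V i) 2 P := by
  have h1 : ∀ ω, ‖fun i => V i ω‖ ≤ ∑ i, ‖V i ω‖ := fun ω =>
    (pi_norm_le_iff_of_nonneg (Finset.sum_nonneg fun i _ => norm_nonneg _)).2 fun i =>
      Finset.single_le_sum (f := fun i => ‖V i ω‖) (fun i _ => norm_nonneg _) (Finset.mem_univ i)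
  have h2 : eLpNorm (fun ω i => V i ω) 2 P ≤ eLpNorm (∑ i, fun ω => ‖V i ω‖) 2 P := by
    refine eLpNorm_mono_real fun ω => ?_
    simpa only [Finset.sum_apply] using h1 ω
  refine (h2.trans (eLpNorm_sum_le (fun i _ => (hV i).norm) one_le_two)).trans_eq ?_
  exact Finset.sum_congr rfl fun i _ => eLpNorm_norm _

theorem tendstoInMeasure_pi {Ω : Type*} [MeasurableSpace Ω] {P : Measure Ω} {n : ℕ}
    {U : ℕ → Fin n → Ω → ℝ} {V : Fin n → Ω → ℝ}
    (hU : ∀ k i, AEStronglyMeasurable (U k i) P) (hV : ∀ i, AEStronglyMeasurable (V i) P)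
    (h : ∀ i, Tendsto (fun k => eLpNorm (fun ω => V i ω - U k i ω) 2 P) atTop (𝓝 0)) :
    TendstoInMeasure P (fun k ω i => U k i ω) atTop (fun ω i => V i ω) := by
  have hUm : ∀ k, AEStronglyMeasurable (fun ω i => U k i ω) P := fun k =>
    (aemeasurable_pi_lambda _ fun i => (hU k i).aemeasurable).aestronglyMeasurable
  have hVm : AEStronglyMeasurable (fun ω i => V i ω) P :=
    (aemeasurable_pi_lambda _ fun i => (hV i).aemeasurable).aestronglyMeasurable
  have hs : Tendsto (fun k => ∑ i, eLpNorm (fun ω => V i ω - U k i ω) 2 P) atTop (𝓝 0) := by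
    simpa using tendsto_finsetSum Finset.univ fun i _ => h i
  refine tendstoInMeasure_of_tendsto_eLpNorm two_ne_zero hUm hVm ?_
  refine tendsto_of_tendsto_of_tendsto_of_le_of_le tendsto_const_nhds hs
    (fun _ => zero_le) fun k => ?_
  rw [eLpNorm_sub_comm]
  exact eLpNorm_pi_le_sum fun i => (hV i).sub (hU k i)

/-- Convergence in `L²` implies convergence in measure and hence in distribution, where limit laws
are unique. -/
theorem identDistrib_of_tendsto_eLpNorm {Ω : Type*} [MeasurableSpace Ω] {P : Measure Ω}
    [IsProbabilityMeasure P] {n : ℕ} {U U' : ℕ → Fin n → Ω → ℝ} {V V' : Fin n → Ω → ℝ}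
    (hV : ∀ i, AEStronglyMeasurable (V i) P) (hV' : ∀ i, AEStronglyMeasurable (V' i) P)
    (hUU' : ∀ k, IdentDistrib (fun ω i => U k i ω) (fun ω i => U' k i ω) P P)
    (h : ∀ i, Tendsto (fun k => eLpNorm (fun ω => V i ω - U k i ω) 2 P) atTop (𝓝 0))
    (h' : ∀ i, Tendsto (fun k => eLpNorm (fun ω => V' i ω - U' k i ω) 2 P) atTop (𝓝 0)) :
    IdentDistrib (fun ω i => V i ω) (fun ω i => V' i ω) P P := by
  have hU := fun k => (hUU' k).aemeasurable_fst
  have hU' := fun k => (hUU' k).aemeasurable_snd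
  have t := (tendstoInMeasure_pi (fun k i => (aemeasurable_pi_iff.1 (hU k) i).aestronglyMeasurable)
    hV h).tendstoInDistribution hU
  have t' := (tendstoInMeasure_pi
    (fun k i => (aemeasurable_pi_iff.1 (hU' k) i).aestronglyMeasurable) hV'
    h').tendstoInDistribution hU'
  refine ⟨t.aemeasurable_limit, t'.aemeasurable_limit, ?_⟩
  refine tendstoInDistribution_unique _ t ⟨hU, t'.aemeasurable_limit, ?_⟩
  refine t'.tendsto.congr fun k => Subtype.ext (hUU' k).map_eq.symm

/-! ### Stochastic integrals -/

/-- A bounded function that is measurable for the sigma-algebra generated by `Z` is a bounded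
measurable function of `Z`. -/
theorem exists_bounded_measurable_factor {Ω E : Type*} [mE : MeasurableSpace E] {Z : Ω → E}
    {ξ : Ω → ℝ} (hξ : Measurable[mE.comap Z] ξ) (hb : ∃ C, ∀ ω, |ξ ω| ≤ C) :
    ∃ F : E → ℝ, Measurable F ∧ (∃ C, ∀ x, |F x| ≤ C) ∧ ∀ ω, ξ ω = F (Z ω) := by
  obtain ⟨C, hC⟩ := hb
  obtain ⟨F, hF, hFξ⟩ := hξ.exists_eq_measurable_comp
  -- The factor `F` is controlled only on the range of `Z`; truncation bounds it everywhere and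
  -- changes nothing there. Using `|C|` keeps the interval nonempty even if `C < 0`, which can occur
  -- when `Ω` is empty.
  refine ⟨fun x => max (-|C|) (min |C| (F x)), measurable_const.max (measurable_const.min hF),
    ⟨|C|, fun x => abs_le.2 ⟨le_max_left _ _, max_le ?_ (min_le_left _ _)⟩⟩, fun ω => ?_⟩
  · exact (neg_nonpos.2 (abs_nonneg C)).trans (abs_nonneg C)
  · have h := abs_le.1 ((hC ω).trans (le_abs_self C))
    have e : F (Z ω) = ξ ω := by rw [hFξ, Function.comp_apply]
    simp only [e, min_eq_right h.2, max_eq_right h.1]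

namespace IsStochasticIntegral

variable {Ω : Type u} [MeasurableSpace Ω] {P : Measure Ω} {S : Type*} [MeasurableSpace S]
  {c : Measure S} {W : FiniteSets c → Ω → ℝ} {E : Type*} [mE : MeasurableSpace E] {Z : Ω → E}
  {φ : S → Ω → ℝ} {I : Ω → ℝ}

/-- Writing the coefficients as functions of `Z` makes it possible to substitute a shifted path for
`Z` later. -/
theorem exists_seq (hI : IsStochasticIntegral (mE.comap Z) P c W φ I) :
    ∃ (N : ℕ → ℕ) (A : ∀ k, Fin (N k) → FiniteSets c) (F : ∀ k, Fin (N k) → E → ℝ),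
      (∀ k i, Measurable (F k i)) ∧ (∀ k i, ∃ C, ∀ x, |F k i x| ≤ C) ∧
      Tendsto (fun k => eLpNorm (fun q : S × Ω => φ q.1 q.2 -
        ∑ i, (A k i).1.indicator (fun _ => F k i (Z q.2)) q.1) 2 (c.prod P)) atTop (𝓝 0) ∧
      Tendsto (fun k => eLpNorm (fun ω => I ω - ∑ i, F k i (Z ω) * W (A k i) ω) 2 P)
        atTop (𝓝 0) := by
  obtain ⟨-, ψ, hψ, h1, h2⟩ := hI
  choose F hF hFb hFξ using fun k i => exists_bounded_measurable_factor (hψ k i).1 (hψ k i).2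
  refine ⟨fun k => (ψ k).n, fun k => (ψ k).A, F, hF, hFb, ?_, ?_⟩
  · simpa only [SimpleIntegrand.eval, hFξ] using h1
  · simpa only [SimpleIntegrand.integral, hFξ] using h2

variable [IsProbabilityMeasure P]

/-- The integral does not depend on the approximating sequence: by the isometry two simple integrals
are as far apart as their integrands, and both integrands are close to `φ`. -/
theorem tendsto_eLpNorm [SigmaFinite c]
    (hI : IsStochasticIntegral (mE.comap Z) P c W φ I)
    (hW : IsGaussianRandomMeasure P c W) (hZ : Measurable Z)
    (hind : IndepFun Z (fun ω A => W A ω) P)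
    (hφ : AEStronglyMeasurable (fun q : S × Ω => φ q.1 q.2) (c.prod P)) {M : ℕ → ℕ}
    (B : ∀ k, Fin (M k) → FiniteSets c) {G : ∀ k, Fin (M k) → E → ℝ}
    (hG : ∀ k i, Measurable (G k i)) (hGb : ∀ k i, ∃ C, ∀ x, |G k i x| ≤ C)
    (h : Tendsto (fun k => eLpNorm (fun q : S × Ω => φ q.1 q.2 -
      ∑ i, (B k i).1.indicator (fun _ => G k i (Z q.2)) q.1) 2 (c.prod P)) atTop (𝓝 0)) :
    Tendsto (fun k => eLpNorm (fun ω => I ω - ∑ i, G k i (Z ω) * W (B k i) ω) 2 P)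
      atTop (𝓝 0) := by
  obtain ⟨N, A, F, hF, hFb, h1, h2⟩ := hI.exists_seq
  have hsum := (h2.add (h1.add h))
  simp only [add_zero] at hsum
  refine tendsto_of_tendsto_of_tendsto_of_le_of_le tendsto_const_nhds hsum
    (fun _ => zero_le) fun k => ?_
  have mI : ∀ {n : ℕ} (A : Fin n → FiniteSets c) {F : Fin n → E → ℝ},
      (∀ i, Measurable (F i)) → AEStronglyMeasurable (fun ω => ∑ i, F i (Z ω) * W (A i) ω) P :=
    fun A F hF => (Finset.measurable_sum _ fun i _ =>
      ((hF i).comp hZ).mul (hW.measurable (A i))).aestronglyMeasurable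
  have mS : ∀ {n : ℕ} (A : Fin n → FiniteSets c) {F : Fin n → E → ℝ},
      (∀ i, Measurable (F i)) → AEStronglyMeasurable (fun q : S × Ω =>
        ∑ i, (A i).1.indicator (fun _ => F i (Z q.2)) q.1) (c.prod P) :=
    fun A F hF => (Finset.measurable_sum _ fun i _ => (((hF i).comp hZ).comp
      measurable_snd).indicator (measurable_fst (A i).2.1)).aestronglyMeasurable
  have e1 : (fun ω => I ω - ∑ i, G k i (Z ω) * W (B k i) ω) =
      (fun ω => I ω - ∑ i, F k i (Z ω) * W (A k i) ω) +
        fun ω => ∑ i, F k i (Z ω) * W (A k i) ω - ∑ i, G k i (Z ω) * W (B k i) ω := by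
    ext ω
    simp
  have e2 : (fun q : S × Ω => ∑ i, (A k i).1.indicator (fun _ => F k i (Z q.2)) q.1 -
      ∑ i, (B k i).1.indicator (fun _ => G k i (Z q.2)) q.1) =
      (fun q : S × Ω => φ q.1 q.2 - ∑ i, (B k i).1.indicator (fun _ => G k i (Z q.2)) q.1) -
        fun q : S × Ω => φ q.1 q.2 -
          ∑ i, (A k i).1.indicator (fun _ => F k i (Z q.2)) q.1 := by
    ext q
    simp
  rw [e1]
  refine (eLpNorm_add_le (hI.1.1.sub (mI (A k) (hF k)))
    ((mI (A k) (hF k)).sub (mI (B k) (hG k))) one_le_two).trans (add_le_add le_rfl ?_)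
  refine (hW.eLpNorm_sum_sub_sum hZ hind (A k) (B k) (hF k) (hFb k) (hG k) (hGb k)).trans_le ?_
  rw [e2, add_comm]
  exact eLpNorm_sub_le (hφ.sub (mS (B k) (hG k))) (hφ.sub (mS (A k) (hF k))) one_le_two

/-- Simple integrals have mean zero by independence, and on a probability space `L²`-convergence
carries means to the limit. -/
theorem integral_eq_zero (hI : IsStochasticIntegral (mE.comap Z) P c W φ I)
    (hW : IsGaussianRandomMeasure P c W) (hZ : Measurable Z)
    (hind : IndepFun Z (fun ω A => W A ω) P) : ∫ ω, I ω ∂P = 0 := by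
  obtain ⟨N, A, F, hF, hFb, -, h2⟩ := hI.exists_seq
  have mI : ∀ k, MemLp (fun ω => ∑ i, F k i (Z ω) * W (A k i) ω) 2 P := fun k =>
    memLp_finsetSum _ fun i _ => by
      obtain ⟨C, hC⟩ := hFb k i
      exact hW.memLp_mul hZ (A k i) (hF k i) hC
  have h1 : Tendsto (fun k => eLpNorm (fun ω => (∑ i, F k i (Z ω) * W (A k i) ω) - I ω) 1 P)
      atTop (𝓝 0) := by
    refine tendsto_of_tendsto_of_tendsto_of_le_of_le tendsto_const_nhds h2
      (fun _ => zero_le) fun k => ?_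
    exact (eLpNorm_le_eLpNorm_of_exponent_le one_le_two ((mI k).1.sub hI.1.1)).trans_eq
      (eLpNorm_sub_comm _ _ _ _)
  have h3 := tendsto_integral_of_L1' I hI.1.1
    (Eventually.of_forall fun k => (mI k).integrable one_le_two) h1
  refine tendsto_nhds_unique h3 ?_
  simp only [hW.integral_sum_eq_zero hZ hind (A _) (hF _) (hFb _)]
  exact tendsto_const_nhds

end IsStochasticIntegral

/-! ### Stationarity of volatility modulated mixed moving averages -/

/-- Finite dimensional distributions determine a finite measure on the product sigma-algebra. The
law of the whole path is needed because the coefficients of simple integrands may depend on all of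
`σ`. -/
theorem IsStrictlyStationary.identDistrib_path {Ω : Type u} [MeasurableSpace Ω] {P : Measure Ω}
    [IsFiniteMeasure P] {σ : ℝ → Ω → ℝ} (hσ : IsStrictlyStationary P σ)
    (hm : ∀ s, Measurable (σ s)) (τ : ℝ) :
    IdentDistrib (fun ω s => σ s ω) (fun ω s => σ (s + τ) ω) P P := by
  rw [identDistrib_iff_forall_finset_identDistrib
    (measurable_pi_lambda _ fun s => hm s).aemeasurable
    (measurable_pi_lambda _ fun s => hm (s + τ)).aemeasurable]
  intro I
  have h := (hσ τ I.card fun i => I.equivFin.symm i).symm.comp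
    (u := fun (v : Fin I.card → ℝ) (i : I) => v (I.equivFin i)) (by fun_prop)
  simpa [Function.comp_def, Finset.restrict_def] using h

/-- Translation of the time variable. -/
def timeTranslate {𝓧 : Type v} (τ : ℝ) (z : 𝓧 × ℝ) : 𝓧 × ℝ := (z.1, z.2 - τ)

theorem measurePreserving_timeTranslate {𝓧 : Type v} [MeasurableSpace 𝓧] (p : Measure 𝓧)
    [SigmaFinite p] (τ : ℝ) :
    MeasurePreserving (timeTranslate τ) (p.prod (volume : Measure ℝ)) (p.prod volume) :=
  (MeasurePreserving.id p).prod (measurePreserving_sub_right volume τ)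

theorem eLpNorm_prod_congr {Ω S : Type*} [MeasurableSpace Ω] [MeasurableSpace S]
    {P : Measure Ω} [SFinite P] {c : Measure S} {f g : S × Ω → ℝ} (hf : Measurable f)
    (hg : Measurable g)
    (h : ∀ z, eLpNorm (fun ω => f (z, ω)) 2 P = eLpNorm (fun ω => g (z, ω)) 2 P) :
    eLpNorm f 2 (c.prod P) = eLpNorm g 2 (c.prod P) := by
  have key : ∀ f : Ω → ℝ, ∫⁻ ω, ‖f ω‖ₑ ^ (2 : ℝ) ∂P = eLpNorm f 2 P ^ (2 : ℝ) := fun f => by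
    rw [eLpNorm_eq_lintegral_rpow_enorm_toReal (by simp) (by simp), ← ENNReal.rpow_mul]
    simp
  have h' : ∀ z, ∫⁻ ω, ‖f (z, ω)‖ₑ ^ (2 : ℝ) ∂P = ∫⁻ ω, ‖g (z, ω)‖ₑ ^ (2 : ℝ) ∂P := fun z => by
    rw [key fun ω => f (z, ω), key fun ω => g (z, ω), h]
  rw [eLpNorm_eq_lintegral_rpow_enorm_toReal (by simp) (by simp),
    eLpNorm_eq_lintegral_rpow_enorm_toReal (by simp) (by simp),
    lintegral_prod _ (by fun_prop), lintegral_prod _ (by fun_prop)]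
  simp only [ENNReal.toReal_ofNat, h']

namespace IsVMMMAOf

variable {Ω : Type u} [MeasurableSpace Ω] {P : Measure Ω} {𝓧 : Type v} [MeasurableSpace 𝓧]
  {p : Measure 𝓧} {g : 𝓧 × ℝ → ℝ} {σ : ℝ → Ω → ℝ}
  {W : FiniteSets (p.prod (volume : Measure ℝ)) → Ω → ℝ} {X : ℝ → Ω → ℝ}

theorem measurable_volatility_apply (hX : IsVMMMAOf P p g σ W X) (s : ℝ) : Measurable (σ s) :=
  hX.measurable_volatility.comp measurable_prodMk_left

theorem measurable_path (hX : IsVMMMAOf P p g σ W X) : Measurable fun ω s => σ s ω :=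
  measurable_pi_lambda _ hX.measurable_volatility_apply

theorem measurable_integrand (hX : IsVMMMAOf P p g σ W X) (t τ : ℝ) :
    Measurable fun q : (𝓧 × ℝ) × Ω => g (q.1.1, t - q.1.2) * σ (q.1.2 + τ) q.2 :=
  (hX.measurable_weight.comp (by fun_prop)).mul (hX.measurable_volatility.comp
    (g := fun q : ℝ × Ω => σ q.1 q.2) (f := fun q : (𝓧 × ℝ) × Ω => (q.1.2 + τ, q.2))
    (by fun_prop))

theorem measurable_integrand_sub_sum (hX : IsVMMMAOf P p g σ W X) (t τ : ℝ) {n : ℕ}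
    (A : Fin n → FiniteSets (p.prod (volume : Measure ℝ))) {F : Fin n → (ℝ → ℝ) → ℝ}
    (hF : ∀ i, Measurable (F i)) :
    Measurable fun q : (𝓧 × ℝ) × Ω => g (q.1.1, t - q.1.2) * σ (q.1.2 + τ) q.2 -
      ∑ i, (A i).1.indicator (fun _ => F i fun s => σ (s + τ) q.2) q.1 :=
  (hX.measurable_integrand t τ).sub (Finset.measurable_sum _ fun i _ =>
    (((hF i).comp (measurable_pi_lambda _ fun s => hX.measurable_volatility_apply (s + τ))).comp
      measurable_snd).indicator (measurable_fst (A i).2.1))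

variable [IsProbabilityMeasure P]

/-- Translating the sets and the volatility of a simple integrand does not change its distance
from the correspondingly translated integrand. -/
theorem eLpNorm_translate [IsProbabilityMeasure p] (hX : IsVMMMAOf P p g σ W X) (t τ : ℝ) {n : ℕ}
    (A : Fin n → FiniteSets (p.prod (volume : Measure ℝ))) {F : Fin n → (ℝ → ℝ) → ℝ}
    (hF : ∀ i, Measurable (F i)) :
    eLpNorm (fun q : (𝓧 × ℝ) × Ω => g (q.1.1, t + τ - q.1.2) * σ q.1.2 q.2 -
      ∑ i, ((A i).preimage (measurePreserving_timeTranslate p τ)).1.indicator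
        (fun _ => F i fun s => σ (s + τ) q.2) q.1) 2 ((p.prod volume).prod P) =
    eLpNorm (fun q : (𝓧 × ℝ) × Ω => g (q.1.1, t - q.1.2) * σ q.1.2 q.2 -
      ∑ i, (A i).1.indicator (fun _ => F i fun s => σ s q.2) q.1) 2
        ((p.prod volume).prod P) := by
  have m0 := hX.measurable_integrand_sub_sum t 0 A hF
  simp only [add_zero] at m0
  have m1 := hX.measurable_integrand_sub_sum t τ A hF
  -- Two moves: the change of variables `z ↦ timeTranslate τ z` puts the shift on `σ` alone, and
  -- then, for each fixed `z`, stationarity of the path of `σ` removes it.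
  rw [← eLpNorm_prod_congr m1 m0 fun z => ?_, ← eLpNorm_comp_measurePreserving
    m1.aestronglyMeasurable ((measurePreserving_timeTranslate p τ).prod (MeasurePreserving.id P))]
  · congr 1
    ext q
    simp only [Function.comp_apply, Prod.map_fst, Prod.map_snd, id_eq, timeTranslate,
      FiniteSets.preimage, sub_add_cancel]
    congr 2
    ring_nf
  · have h := (hX.stationary_volatility.identDistrib_path hX.measurable_volatility_apply τ).comp
      (u := fun v : ℝ → ℝ => g (z.1, t - z.2) * v z.2 -
        ∑ i, (A i).1.indicator (fun _ => F i v) z) (by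
        refine ((measurable_pi_apply _).const_mul _).sub (Finset.measurable_sum _ fun i _ => ?_)
        by_cases hz : z ∈ (A i).1
        · simpa [hz] using hF i
        · simp [hz])
    exact (h.eLpNorm_eq 2).symm

theorem isStrictlyStationary (hX : IsVMMMAOf P p g σ W X) : IsStrictlyStationary P X := by
  intro τ n t
  have := hX.probability
  have hσ := hX.stationary_volatility.identDistrib_path hX.measurable_volatility_apply τ
  have hsh : Measurable fun (v : ℝ → ℝ) s => v (s + τ) :=
    measurable_pi_lambda _ fun s => measurable_pi_apply _
  choose N A F hF hFb h1 h2 using fun i => (hX.eq_integral (t i)).exists_seq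
  have h3 : ∀ i, Tendsto (fun k => eLpNorm (fun ω => X (t i + τ) ω -
      ∑ j, F i k j (fun s => σ (s + τ) ω) *
        W ((A i k j).preimage (measurePreserving_timeTranslate p τ)) ω) 2 P) atTop (𝓝 0) := by
    intro i
    refine (hX.eq_integral (t i + τ)).tendsto_eLpNorm hX.gaussian hX.measurable_path hX.indep
      (by simpa using (hX.measurable_integrand (t i + τ) 0).aestronglyMeasurable)
      (fun k j => (A i k j).preimage (measurePreserving_timeTranslate p τ))
      (G := fun k j v => F i k j fun s => v (s + τ)) (fun k j => (hF i k j).comp hsh)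
      (fun k j => (hFb i k j).imp fun C hC v => hC _) ?_
    refine (h1 i).congr fun k => ?_
    exact (hX.eLpNorm_translate (t i) τ (A i k) (hF i k)).symm
  refine (identDistrib_of_tendsto_eLpNorm (fun i => (hX.eq_integral (t i)).1.1)
    (fun i => (hX.eq_integral (t i + τ)).1.1) (fun k => ?_) h2 h3).symm
  -- All times are treated at once: the simple integrals for the various `t i` form one family over
  -- pairs `(i, j)`, and summing over `j` recovers their joint law.
  have h := (hX.gaussian.identDistrib_mul hσ hX.indep
    (hX.indep.comp hsh measurable_id) (measurePreserving_timeTranslate p τ)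
    (fun x : (i : Fin n) × Fin (N i k) => A x.1 k x.2) (F := fun x => F x.1 k x.2)
    fun x => hF x.1 k x.2).comp
    (u := fun (v : ((i : Fin n) × Fin (N i k)) → ℝ) (i : Fin n) => ∑ j, v ⟨i, j⟩) (by fun_prop)
  exact h

theorem isCentredStationary (hX : IsVMMMAOf P p g σ W X) : IsCentredStationary P X where
  memLp t := (hX.eq_integral t).1
  centred t := (hX.eq_integral t).integral_eq_zero hX.gaussian hX.measurable_path hX.indep
  stationary := hX.isStrictlyStationary

end IsVMMMAOf

theorem mainTheorem12 {Ω : Type u} [MeasurableSpace Ω] (P : Measure Ω) [IsProbabilityMeasure P]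
    (H : ℝ) (hH0 : 0 < H) (hH1 : H < 1) (X : ℝ → Ω → ℝ)
    (hX : IsVMMMA.{u, v} P X ∨ IsCentredStationary P X)
    (hγ : HasSpectralDensity P X (spectralDensity H)) :
    (∀ w : ℝ, Summable (spectralTerm H w)) ∧
    (∀ h : ℝ, correlationFunction P X h =
      Real.cosh (h * H) - 2 ^ (2 * H - 1) * |Real.sinh (h / 2)| ^ (2 * H)) ∧
    IsSelfSimilar P H (lamperti H X) ∧
    HasSecondOrderStationaryIncrements P (lamperti H X) := by
  have hρ := hγ.correlationFunction_eq hH0 hH1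
  have hc : IsCentredStationary P X := by
    rcases hX with ⟨𝓧, _, p, g, σ, W, h⟩ | h
    exacts [h.isCentredStationary, h]
  exact ⟨summable_spectralTerm hH0 hH1, hρ, hc.isSelfSimilar_lamperti hH0,
    hc.hasSecondOrderStationaryIncrements_lamperti hH0 hρ⟩
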